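/- Let $\mathbb{T}=\mathbb{R}/2\pi\mathbb{Z}$, $\alpha\in(0,1)$ and $F\in C^4(\mathbb{R};\mathbb{R})$. Let $\psi_0\in C^3(\mathbb{T}\times(-1,1))\cap C^1(\mathbb{T}\times[-1,1])$ be a not identically zero solution of $$\Delta\psi_0=F(\psi_0)\ \text{ in }\mathbb{T}\times(-1,1),\qquad \psi_0(x,\pm1)=0\ \text{ for }x\in\mathbb{T},$$ such that the linearized Dirichlet problem $$\Delta\phi-F'(\psi_0)\phi=0\ \text{ in }\mathbb{T}\times(-1,1),\qquad \phi(x,\pm1)=0\ \text{ for }x\in\mathbb{T},$$ has only the trivial solution $\phi=0$ in $C^2(\mathbb{T}\times(-1,1))\cap C(\mathbb{T}\times[-1,1])$, and such that $\partial_y\psi_0(x,1)\,\partial_y\psi_0(x,-1)\le 0$ for all $x\in\mathbb{T}$ (which is automatic if $\psi_0$ does not change sign, and also if $F'>-\lambda_1$, where $\lambda_1$ is the first Dirichlet eigenvalue of $-\Delta$ on $\mathbb{T}\times(-1,1)$). Let $g,h\in C^{2,\alpha}(\mathbb{T})$ and let $\varphi\in C^2(\mathbb{T}\times(-1,1))\cap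 C(\mathbb{T}\times[-1,1])$ be the first order correction to $\psi_0$ associated with the perturbed channel $\{-1-\varepsilon g(x)\le y\le 1+\varepsilon h(x)\}$, that is, the solution of $$\begin{cases}\Delta\varphi-F'(\psi_0)\varphi=0 & \text{in }\mathbb{T}\times(-1,1),\\ \varphi(x,1)=-h(x)\,\partial_y\psi_0(x,1) & \text{for }x\in\mathbb{T},\\ \varphi(x,-1)=g(x)\,\partial_y\psi_0(x,-1) & \text{for }x\in\mathbb{T}.\end{cases}$$ Then $\partial_x\varphi(x,0)\not\equiv0$ if and only if $h'(x)+g'(x)\not\equiv0$. -/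

import Mathlib

open Set

namespace FlatChannel

/-- The open strip `ℝ × (-1, 1)`, the universal cover of the open channel `𝕋 × (-1, 1)`,
where `𝕋 = ℝ / 2πℤ`. -/
def openStrip : Set (ℝ × ℝ) := univ ×ˢ Ioo (-1 : ℝ) 1

/-- The closed strip `ℝ × [-1, 1]`, the universal cover of `𝕋 × [-1, 1]`. -/
def closedStrip : Set (ℝ × ℝ) := univ ×ˢ Icc (-1 : ℝ) 1

/-- `u` descends to a function on the closed channel `𝕋 × [-1, 1]`. The values of `u` off the
closed strip play no role. -/
def XPeriodic (u : ℝ × ℝ → ℝ) : Prop :=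
  ∀ x : ℝ, ∀ y ∈ Icc (-1 : ℝ) 1, u (x + 2 * Real.pi, y) = u (x, y)

/-- The Laplacian `∂ₓ² u + ∂_y² u` at `(x, y)`; only used at points of the open strip. -/
noncomputable def lap (u : ℝ × ℝ → ℝ) (x y : ℝ) : ℝ :=
  iteratedDeriv 2 (fun s : ℝ => u (s, y)) x + iteratedDeriv 2 (fun t : ℝ => u (x, t)) y

/-- `∂_y u (x, y)` for `-1 ≤ y ≤ 1`; it is the one-sided derivative from inside the channel
when `y = 1` or `y = -1`. -/
noncomputable def dy (u : ℝ × ℝ → ℝ) (x y : ℝ) : ℝ :=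
  derivWithin (fun t : ℝ => u (x, t)) (Icc (-1 : ℝ) 1) y

/-- `g ∈ C^{2,α}(𝕋)`: a `2π`-periodic `C²` function whose second derivative is `α`-Hölder. -/
def HolderTwo (α : NNReal) (g : ℝ → ℝ) : Prop :=
  Function.Periodic g (2 * Real.pi) ∧ ContDiff ℝ 2 g ∧
    ∃ C : NNReal, HolderWith C α (iteratedDeriv 2 g)

/-- The stream function `ψ₀` of a steady state on the flat channel with trivial homology:
`Δψ₀ = F(ψ₀)` in `𝕋 × (-1, 1)` and `ψ₀ = 0` on both boundary components, with
`ψ₀ ∈ C³(𝕋 × (-1, 1)) ∩ C¹(𝕋 × [-1, 1])`. -/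
structure IsBaseFlow (F : ℝ → ℝ) (ψ₀ : ℝ × ℝ → ℝ) : Prop where
  periodic : XPeriodic ψ₀
  contDiffOn_open : ContDiffOn ℝ 3 ψ₀ openStrip
  contDiffOn_closed : ContDiffOn ℝ 1 ψ₀ closedStrip
  equation : ∀ x : ℝ, ∀ y ∈ Ioo (-1 : ℝ) 1, lap ψ₀ x y = F (ψ₀ (x, y))
  top : ∀ x : ℝ, ψ₀ (x, 1) = 0
  bottom : ∀ x : ℝ, ψ₀ (x, -1) = 0

/-- `φ ∈ C²(𝕋 × (-1, 1)) ∩ C(𝕋 × [-1, 1])` is a classical solution of the linearized equation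
`Δφ - F'(ψ₀) φ = 0` in `𝕋 × (-1, 1)`. -/
structure IsLinearizedSolution (F : ℝ → ℝ) (ψ₀ φ : ℝ × ℝ → ℝ) : Prop where
  periodic : XPeriodic φ
  contDiffOn : ContDiffOn ℝ 2 φ openStrip
  continuousOn : ContinuousOn φ closedStrip
  equation : ∀ x : ℝ, ∀ y ∈ Ioo (-1 : ℝ) 1, lap φ x y - deriv F (ψ₀ (x, y)) * φ (x, y) = 0

/-- The linearized problem with zero Dirichlet data admits only the trivial solution. -/
def Nondegenerate (F : ℝ → ℝ) (ψ₀ : ℝ × ℝ → ℝ) : Prop :=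
  ∀ φ : ℝ × ℝ → ℝ, IsLinearizedSolution F ψ₀ φ →
    (∀ x : ℝ, φ (x, 1) = 0) → (∀ x : ℝ, φ (x, -1) = 0) → ∀ p ∈ closedStrip, φ p = 0

/-- `φ` is the first order correction to `ψ₀` when the channel is deformed to
`{-1 + ε b(x) ≤ y ≤ 1 + ε t(x)}`: it solves the linearized equation with
`φ(x, 1) = -t(x) ∂_yψ₀(x, 1)` and `φ(x, -1) = -b(x) ∂_yψ₀(x, -1)`. -/
structure IsFirstOrderCorrection (F : ℝ → ℝ) (ψ₀ : ℝ × ℝ → ℝ) (b t : ℝ → ℝ)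
    (φ : ℝ × ℝ → ℝ) : Prop where
  solution : IsLinearizedSolution F ψ₀ φ
  top : ∀ x : ℝ, φ (x, 1) = -t x * dy ψ₀ x 1
  bottom : ∀ x : ℝ, φ (x, -1) = -b x * dy ψ₀ x (-1)

end FlatChannel

namespace FlatChannel

open scoped Pointwise

/-! Nondegeneracy makes the base flow rigid. The walls are horizontal, so `∂ₓψ₀` solves the
linearized problem with zero data and vanishes: `ψ₀ = ψ(y)` with `ψ'' = F(ψ)`. Conservation of `ψ'²
- 2∫F` between the walls gives `ψ'(1)² = ψ'(-1)²`, and the sign hypothesis selects `ψ'(-1) = -ψ'(1)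
= -c`. ODE uniqueness then makes `ψ` even. Moreover `c ≠ 0`: otherwise `∂_yψ₀` would also have zero
data, forcing `ψ₀ = 0`.

So the linearized equation is invariant under translations in `x` and reflection in `y`. The even
part `Φ(x, y) = φ(x, y) + φ(x, -y)` solves it, with value `-c (h + g)` on both walls and `2φ(x, 0)`
on the axis. Let `w = Φ(· + s, ·) - Φ`. If `h + g` is constant, `w` vanishes on the walls, hence
everywhere, and `φ(·, 0)` is constant. Conversely, if `φ(·, 0)` is constant, `w` vanishes on the
axis together with `∂_y w`, by evenness. Each Fourier mode of `w` in `x` solves a linear second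
order ODE in `y` with zero Cauchy data, so `w = 0` on the upper wall
(`IsLinearizedSolution.top_eq_zero`) and `h + g` is constant. -/

theorem isOpen_openStrip : IsOpen openStrip := isOpen_univ.prod isOpen_Ioo

theorem mem_openStrip {x y : ℝ} : (x, y) ∈ openStrip ↔ y ∈ Ioo (-1 : ℝ) 1 := by
  simp [openStrip]

theorem mem_closedStrip {x y : ℝ} : (x, y) ∈ closedStrip ↔ y ∈ Icc (-1 : ℝ) 1 := by
  simp [closedStrip]

theorem openStrip_subset_closedStrip : openStrip ⊆ closedStrip :=
  prod_mono_right Ioo_subset_Icc_self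

theorem uniqueDiffOn_closedStrip : UniqueDiffOn ℝ closedStrip :=
  uniqueDiffOn_univ.prod (uniqueDiffOn_Icc (by norm_num))

/-! ### Directional derivatives and the Laplacian on the open strip -/

/-- The derivative of `u` in the direction `v`. -/
noncomputable def dirDeriv (v : ℝ × ℝ) (u : ℝ × ℝ → ℝ) : ℝ × ℝ → ℝ :=
  fun p => fderiv ℝ u p v

theorem dirDeriv_congr {u w : ℝ × ℝ → ℝ} (v : ℝ × ℝ) (h : EqOn u w openStrip) :
    EqOn (dirDeriv v u) (dirDeriv v w) openStrip := fun p hp => by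
  have : u =ᶠ[nhds p] w := h.eventuallyEq_of_mem (isOpen_openStrip.mem_nhds hp)
  simp only [dirDeriv, this.fderiv_eq]

theorem contDiffOn_dirDeriv {u : ℝ × ℝ → ℝ} {m n : WithTop ℕ∞} (v : ℝ × ℝ)
    (hu : ContDiffOn ℝ n u openStrip) (hmn : m + 1 ≤ n) :
    ContDiffOn ℝ m (dirDeriv v u) openStrip :=
  (hu.fderiv_of_isOpen isOpen_openStrip hmn).clm_apply contDiffOn_const

theorem dirDeriv_comm {u : ℝ × ℝ → ℝ} (hu : ContDiffOn ℝ 2 u openStrip) (v w : ℝ × ℝ) :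
    EqOn (dirDeriv v (dirDeriv w u)) (dirDeriv w (dirDeriv v u)) openStrip := fun p hp => by
  have hat : ContDiffAt ℝ 2 u p := hu.contDiffAt (isOpen_openStrip.mem_nhds hp)
  have hd : DifferentiableAt ℝ (fderiv ℝ u) p :=
    (hat.fderiv_right (m := 1) (by norm_num)).differentiableAt (by norm_num)
  have key : ∀ a b : ℝ × ℝ, dirDeriv a (dirDeriv b u) p = fderiv ℝ (fderiv ℝ u) p a b := by
    intro a b
    have := (hd.hasFDerivAt.clm_apply (hasFDerivAt_const b p)).fderiv
    change fderiv ℝ (fun q => fderiv ℝ u q b) p a = _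
    rw [this]
    simp
  rw [key, key]
  exact hat.isSymmSndFDerivAt (by simp) v w

theorem hasDerivAt_slice_fst {u : ℝ × ℝ → ℝ} (hu : ContDiffOn ℝ 1 u openStrip) {x y : ℝ}
    (hy : y ∈ Ioo (-1 : ℝ) 1) :
    HasDerivAt (fun s => u (s, y)) (dirDeriv (1, 0) u (x, y)) x := by
  have hat := (hu.contDiffAt (isOpen_openStrip.mem_nhds (mem_openStrip (x := x).2 hy)))
  exact (hat.differentiableAt (by norm_num)).hasFDerivAt.comp_hasDerivAt x
    ((hasDerivAt_id x).prodMk (hasDerivAt_const x y))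

theorem hasDerivAt_slice_snd {u : ℝ × ℝ → ℝ} (hu : ContDiffOn ℝ 1 u openStrip) {x y : ℝ}
    (hy : y ∈ Ioo (-1 : ℝ) 1) :
    HasDerivAt (fun t => u (x, t)) (dirDeriv (0, 1) u (x, y)) y := by
  have hat := (hu.contDiffAt (isOpen_openStrip.mem_nhds (mem_openStrip (x := x).2 hy)))
  exact (hat.differentiableAt (by norm_num)).hasFDerivAt.comp_hasDerivAt y
    ((hasDerivAt_const y x).prodMk (hasDerivAt_id y))

theorem lap_eq {u : ℝ × ℝ → ℝ} (hu : ContDiffOn ℝ 2 u openStrip) {x y : ℝ}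
    (hy : y ∈ Ioo (-1 : ℝ) 1) :
    lap u x y = dirDeriv (1, 0) (dirDeriv (1, 0) u) (x, y)
      + dirDeriv (0, 1) (dirDeriv (0, 1) u) (x, y) := by
  have hu1 : ContDiffOn ℝ 1 u openStrip := hu.of_le (by norm_num)
  have hd : ∀ v, ContDiffOn ℝ 1 (dirDeriv v u) openStrip := fun v =>
    contDiffOn_dirDeriv v hu (by norm_num)
  simp only [lap, iteratedDeriv_succ, iteratedDeriv_zero]
  congr 1
  · rw [show deriv (fun s => u (s, y)) = fun s => dirDeriv (1, 0) u (s, y) from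
      funext fun s => (hasDerivAt_slice_fst hu1 hy).deriv]
    exact (hasDerivAt_slice_fst (hd _) hy).deriv
  · have : deriv (fun t => u (x, t)) =ᶠ[nhds y] fun t => dirDeriv (0, 1) u (x, t) := by
      filter_upwards [isOpen_Ioo.mem_nhds hy] with t ht
      exact (hasDerivAt_slice_snd hu1 ht).deriv
    rw [this.deriv_eq]
    exact (hasDerivAt_slice_snd (hd _) hy).deriv

/-! ### Derivatives of the base flow as linearized solutions -/

/-- Differentiating the semilinear equation in a fixed direction gives the linearized equation. -/
theorem IsBaseFlow.lap_dirDeriv {F : ℝ → ℝ} {ψ : ℝ × ℝ → ℝ} (hF : ContDiff ℝ 1 F)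
    (hψ : IsBaseFlow F ψ) (v : ℝ × ℝ) {x y : ℝ} (hy : y ∈ Ioo (-1 : ℝ) 1) :
    lap (dirDeriv v ψ) x y = deriv F (ψ (x, y)) * dirDeriv v ψ (x, y) := by
  have h3 := hψ.contDiffOn_open
  have h2 : ContDiffOn ℝ 2 ψ openStrip := h3.of_le (by norm_num)
  have hd : ∀ w, ContDiffOn ℝ 2 (dirDeriv w ψ) openStrip := fun w =>
    contDiffOn_dirDeriv w h3 (by norm_num)
  have hdd : ∀ w, ContDiffOn ℝ 1 (dirDeriv w (dirDeriv w ψ)) openStrip := fun w =>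
    contDiffOn_dirDeriv w (hd w) (by norm_num)
  have hp : (x, y) ∈ openStrip := mem_openStrip.2 hy
  have swap : ∀ w, dirDeriv w (dirDeriv w (dirDeriv v ψ)) (x, y)
      = dirDeriv v (dirDeriv w (dirDeriv w ψ)) (x, y) := fun w => by
    rw [dirDeriv_congr w (dirDeriv_comm h2 w v) hp, dirDeriv_comm (hd w) w v hp]
  have hat : ∀ w, DifferentiableAt ℝ (dirDeriv w (dirDeriv w ψ)) (x, y) := fun w =>
    ((hdd w).contDiffAt (isOpen_openStrip.mem_nhds hp)).differentiableAt (by norm_num)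
  have heq : EqOn (dirDeriv (1, 0) (dirDeriv (1, 0) ψ) + dirDeriv (0, 1) (dirDeriv (0, 1) ψ))
      (F ∘ ψ) openStrip := by
    rintro ⟨a, b⟩ hab
    rw [mem_openStrip] at hab
    rw [Pi.add_apply, ← lap_eq h2 hab, hψ.equation a b hab]
    rfl
  have hψat : DifferentiableAt ℝ ψ (x, y) :=
    (h2.contDiffAt (isOpen_openStrip.mem_nhds hp)).differentiableAt (by norm_num)
  have hFat : HasDerivAt F (deriv F (ψ (x, y))) (ψ (x, y)) :=
    (hF.differentiable (by norm_num) _).hasDerivAt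
  have hsum : dirDeriv v (dirDeriv (1, 0) (dirDeriv (1, 0) ψ)) (x, y)
      + dirDeriv v (dirDeriv (0, 1) (dirDeriv (0, 1) ψ)) (x, y) = dirDeriv v (F ∘ ψ) (x, y) := by
    rw [← dirDeriv_congr v heq hp]
    simp only [dirDeriv] at hat ⊢
    rw [fderiv_add (hat _) (hat _)]
    rfl
  rw [lap_eq (hd v) hy, swap, swap, hsum]
  simp only [dirDeriv]
  rw [(hFat.comp_hasFDerivAt (x, y) hψat.hasFDerivAt).fderiv]
  simp

/-- Taking the derivative within the closed strip gives a function continuous up to the walls that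
agrees with `dirDeriv v ψ` inside, so `Nondegenerate` can be applied to it. -/
theorem isLinearizedSolution_fderivWithin {F : ℝ → ℝ} {ψ : ℝ × ℝ → ℝ} (hF : ContDiff ℝ 1 F)
    (hψ : IsBaseFlow F ψ) (v : ℝ × ℝ) :
    IsLinearizedSolution F ψ (fun p => fderivWithin ℝ ψ closedStrip p v) := by
  have heq : EqOn (fun p => fderivWithin ℝ ψ closedStrip p v) (dirDeriv v ψ) openStrip :=
    fun p hp => by
      simp only [dirDeriv]
      rw [fderivWithin_of_mem_nhds
        (Filter.mem_of_superset (isOpen_openStrip.mem_nhds hp) openStrip_subset_closedStrip)]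
  have hc2 : ContDiffOn ℝ 2 (fun p => fderivWithin ℝ ψ closedStrip p v) openStrip :=
    (contDiffOn_dirDeriv v hψ.contDiffOn_open (by norm_num)).congr heq
  refine ⟨?_, hc2, ?_, ?_⟩
  · intro x y hy
    have hset : ((2 * Real.pi, 0) : ℝ × ℝ) +ᵥ closedStrip = closedStrip := by
      ext ⟨a, b⟩
      simp [Set.mem_vadd_set_iff_neg_vadd_mem, mem_closedStrip]
    have h1 := fderivWithin_comp_add_right (𝕜 := ℝ) (f := ψ) (x := (x, y)) (s := closedStrip)
      ((2 * Real.pi, 0) : ℝ × ℝ)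
    rw [hset] at h1
    have h2 : fderivWithin ℝ (fun p => ψ (p + (2 * Real.pi, 0))) closedStrip (x, y)
        = fderivWithin ℝ ψ closedStrip (x, y) := by
      refine fderivWithin_congr' ?_ (mem_closedStrip.2 hy)
      rintro ⟨a, b⟩ hab
      simpa using hψ.periodic a b (mem_closedStrip.1 hab)
    have h3 : ((x, y) : ℝ × ℝ) + (2 * Real.pi, 0) = (x + 2 * Real.pi, y) := by simp
    rw [h2, h3] at h1
    simp only [h1]
  · exact (hψ.contDiffOn_closed.continuousOn_fderivWithin uniqueDiffOn_closedStrip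
      le_rfl).clm_apply continuousOn_const
  · intro x y hy
    rw [lap_eq hc2 hy, dirDeriv_congr _ (dirDeriv_congr _ heq) (mem_openStrip.2 hy),
      dirDeriv_congr _ (dirDeriv_congr _ heq) (mem_openStrip.2 hy),
      ← lap_eq (contDiffOn_dirDeriv v hψ.contDiffOn_open (by norm_num)) hy,
      hψ.lap_dirDeriv hF v hy, ← heq (mem_openStrip.2 hy), sub_self]

theorem IsBaseFlow.hasFDerivWithinAt {F : ℝ → ℝ} {ψ : ℝ × ℝ → ℝ} (hψ : IsBaseFlow F ψ)
    {p : ℝ × ℝ} (hp : p ∈ closedStrip) :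
    HasFDerivWithinAt ψ (fderivWithin ℝ ψ closedStrip p) closedStrip p :=
  ((hψ.contDiffOn_closed.differentiableOn (by norm_num)) p hp).hasFDerivWithinAt

theorem IsBaseFlow.hasDerivAt_fst {F : ℝ → ℝ} {ψ : ℝ × ℝ → ℝ} (hψ : IsBaseFlow F ψ)
    (x : ℝ) {y : ℝ} (hy : y ∈ Icc (-1 : ℝ) 1) :
    HasDerivAt (fun s => ψ (s, y)) (fderivWithin ℝ ψ closedStrip (x, y) (1, 0)) x :=
  (hψ.hasFDerivWithinAt (mem_closedStrip.2 hy)).comp_hasDerivAt x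
    ((hasDerivAt_id x).prodMk (hasDerivAt_const x y))
    (Filter.Eventually.of_forall fun _ => mem_closedStrip.2 hy)

theorem IsBaseFlow.hasDerivWithinAt_snd {F : ℝ → ℝ} {ψ : ℝ × ℝ → ℝ} (hψ : IsBaseFlow F ψ)
    (x : ℝ) {y : ℝ} (hy : y ∈ Icc (-1 : ℝ) 1) :
    HasDerivWithinAt (fun t => ψ (x, t)) (fderivWithin ℝ ψ closedStrip (x, y) (0, 1))
      (Icc (-1) 1) y :=
  (hψ.hasFDerivWithinAt (mem_closedStrip.2 hy)).comp_hasDerivWithinAt y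
    ((hasDerivWithinAt_const y _ x).prodMk (hasDerivWithinAt_id y _))
    (fun _ ht => mem_closedStrip.2 ht)

theorem IsBaseFlow.dy_eq {F : ℝ → ℝ} {ψ : ℝ × ℝ → ℝ} (hψ : IsBaseFlow F ψ)
    (x : ℝ) {y : ℝ} (hy : y ∈ Icc (-1 : ℝ) 1) :
    dy ψ x y = fderivWithin ℝ ψ closedStrip (x, y) (0, 1) :=
  (hψ.hasDerivWithinAt_snd x hy).derivWithin (uniqueDiffOn_Icc (by norm_num) y hy)

/-! ### Reduction to a shear profile -/

/-- A nondegenerate base flow is a shear flow. -/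
theorem IsBaseFlow.eq_of_nondegenerate {F : ℝ → ℝ} {ψ : ℝ × ℝ → ℝ} (hF : ContDiff ℝ 1 F)
    (hψ : IsBaseFlow F ψ) (hnd : Nondegenerate F ψ) (x x' : ℝ) {y : ℝ}
    (hy : y ∈ Icc (-1 : ℝ) 1) : ψ (x, y) = ψ (x', y) := by
  have hz := hnd _ (isLinearizedSolution_fderivWithin hF hψ (1, 0))
    (fun x => by
      rw [← (hψ.hasDerivAt_fst x (y := 1) (by norm_num)).deriv]
      simp [hψ.top])
    (fun x => by
      rw [← (hψ.hasDerivAt_fst x (y := -1) (by norm_num)).deriv]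
      simp [hψ.bottom])
  refine is_const_of_deriv_eq_zero (f := fun s => ψ (s, y))
    (fun s => (hψ.hasDerivAt_fst s hy).differentiableAt) (fun s => ?_) x x'
  rw [(hψ.hasDerivAt_fst s hy).deriv]
  exact hz _ (mem_closedStrip.2 hy)

theorem IsBaseFlow.dy_eq_of_nondegenerate {F : ℝ → ℝ} {ψ : ℝ × ℝ → ℝ} (hF : ContDiff ℝ 1 F)
    (hψ : IsBaseFlow F ψ) (hnd : Nondegenerate F ψ) (x x' : ℝ) {y : ℝ}
    (hy : y ∈ Icc (-1 : ℝ) 1) : dy ψ x y = dy ψ x' y :=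
  derivWithin_congr (fun _ ht => hψ.eq_of_nondegenerate hF hnd x x' ht)
    (hψ.eq_of_nondegenerate hF hnd x x' hy)

theorem IsBaseFlow.hasDerivWithinAt_dy {F : ℝ → ℝ} {ψ : ℝ × ℝ → ℝ} (hψ : IsBaseFlow F ψ)
    (x : ℝ) {y : ℝ} (hy : y ∈ Icc (-1 : ℝ) 1) :
    HasDerivWithinAt (fun t => ψ (x, t)) (dy ψ x y) (Icc (-1) 1) y := by
  rw [hψ.dy_eq x hy]
  exact hψ.hasDerivWithinAt_snd x hy

theorem IsBaseFlow.hasDerivAt_snd {F : ℝ → ℝ} {ψ : ℝ × ℝ → ℝ} (hψ : IsBaseFlow F ψ)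
    (x : ℝ) {y : ℝ} (hy : y ∈ Ioo (-1 : ℝ) 1) :
    HasDerivAt (fun t => ψ (x, t)) (dy ψ x y) y :=
  (hψ.hasDerivWithinAt_dy x (Ioo_subset_Icc_self hy)).hasDerivAt (Icc_mem_nhds hy.1 hy.2)

theorem IsBaseFlow.continuousOn_dy {F : ℝ → ℝ} {ψ : ℝ × ℝ → ℝ} (hF : ContDiff ℝ 1 F)
    (hψ : IsBaseFlow F ψ) (x : ℝ) : ContinuousOn (dy ψ x) (Icc (-1) 1) :=
  ((isLinearizedSolution_fderivWithin hF hψ (0, 1)).continuousOn.comp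
    (f := fun t => (x, t)) (by fun_prop) (fun _ ht => mem_closedStrip.2 ht)).congr
    (fun _ ht => hψ.dy_eq x ht)

/-- The profile of a shear base flow solves `ψ'' = F(ψ)`. -/
theorem IsBaseFlow.hasDerivAt_dy {F : ℝ → ℝ} {ψ : ℝ × ℝ → ℝ} (hF : ContDiff ℝ 1 F)
    (hψ : IsBaseFlow F ψ) (hnd : Nondegenerate F ψ) (x : ℝ) {y : ℝ} (hy : y ∈ Ioo (-1 : ℝ) 1) :
    HasDerivAt (dy ψ x) (F (ψ (x, y))) y := by
  have hC2 : ContDiffOn ℝ 2 ψ openStrip := hψ.contDiffOn_open.of_le (by norm_num)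
  have hder : ∀ t ∈ Ioo (-1 : ℝ) 1, dirDeriv (0, 1) ψ (x, t) = dy ψ x t := fun t ht =>
    (hasDerivAt_slice_snd (hC2.of_le (by norm_num)) ht).unique (hψ.hasDerivAt_snd x ht)
  have h1 : HasDerivAt (dy ψ x) (dirDeriv (0, 1) (dirDeriv (0, 1) ψ) (x, y)) y :=
    (hasDerivAt_slice_snd (contDiffOn_dirDeriv (0, 1) hC2 (by norm_num)) hy).congr_of_eventuallyEq
      (by filter_upwards [isOpen_Ioo.mem_nhds hy] with t ht using (hder t ht).symm)
  have h2 : deriv (fun s => ψ (s, y)) = fun _ => 0 := by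
    rw [show (fun s => ψ (s, y)) = fun _ => ψ (0, y) from
      funext fun s => hψ.eq_of_nondegenerate hF hnd s 0 (Ioo_subset_Icc_self hy)]
    simp
  have h3 := hψ.equation x y hy
  simp only [lap, iteratedDeriv_succ, iteratedDeriv_zero, h2, deriv_const, zero_add] at h3
  have h4 : deriv (fun t => ψ (x, t)) =ᶠ[nhds y] dy ψ x := by
    filter_upwards [isOpen_Ioo.mem_nhds hy] with t ht using (hψ.hasDerivAt_snd x ht).deriv
  rw [h4.deriv_eq, h1.deriv] at h3
  rwa [← h3]

/-! ### ODE uniqueness -/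

/-- Uniqueness for second order equations, with initial values taken as one-sided limits. -/
theorem eq_zero_of_norm_deriv_deriv_le {E : Type*} [NormedAddCommGroup E] [NormedSpace ℝ E]
    {u u₁ u₂ : ℝ → E} {a b L : ℝ} (hu : ∀ t ∈ Ioo a b, HasDerivAt u (u₁ t) t)
    (hu₁ : ∀ t ∈ Ioo a b, HasDerivAt u₁ (u₂ t) t)
    (hbound : ∀ t ∈ Ioo a b, ‖u₂ t‖ ≤ L * ‖u t‖)
    (hlim : Filter.Tendsto u (nhdsWithin a (Ioi a)) (nhds 0))
    (hlim₁ : Filter.Tendsto u₁ (nhdsWithin a (Ioi a)) (nhds 0)) :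
    ∀ t ∈ Ioo a b, u t = 0 := by
  intro t ht
  -- In the sup norm, `(u, u₁)' = (u₁, u₂)` is bounded by `K ‖(u, u₁)‖`. Grönwall is run from `r >
  -- a`, with a factor independent of `r`, and then `r → a`.
  set K : ℝ := max 1 |L| with hK
  have hK0 : 0 ≤ K := le_trans zero_le_one (le_max_left _ _)
  have hmain : ∀ r ∈ Ioo a t, ‖u t‖ ≤ ‖(u r, u₁ r)‖ * Real.exp (K * (t - a)) := by
    intro r hr
    have hsub : Icc r t ⊆ Ioo a b := fun s hs => ⟨hr.1.trans_le hs.1, hs.2.trans_lt ht.2⟩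
    have hder : ∀ s ∈ Icc r t, HasDerivAt (fun s => (u s, u₁ s)) (u₁ s, u₂ s) s := fun s hs =>
      (hu s (hsub hs)).prodMk (hu₁ s (hsub hs))
    have h := norm_le_gronwallBound_of_norm_deriv_right_le (f := fun s => (u s, u₁ s))
      (f' := fun s => (u₁ s, u₂ s)) (δ := ‖(u r, u₁ r)‖) (K := K) (ε := 0) (a := r) (b := t)
      (fun s hs => (hder s hs).continuousAt.continuousWithinAt)
      (fun s hs => (hder s (Ico_subset_Icc_self hs)).hasDerivWithinAt) le_rfl
      (fun s hs => by
        have h2 := hbound s (hsub (Ico_subset_Icc_self hs))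
        rw [add_zero, Prod.norm_def, Prod.norm_def]
        have hm0 : 0 ≤ max ‖u s‖ ‖u₁ s‖ := le_max_of_le_left (norm_nonneg _)
        refine max_le ?_ ?_
        · calc ‖u₁ s‖ ≤ 1 * max ‖u s‖ ‖u₁ s‖ := by rw [one_mul]; exact le_max_right _ _
            _ ≤ _ := mul_le_mul_of_nonneg_right (le_max_left _ _) hm0
        · calc ‖u₂ s‖ ≤ L * ‖u s‖ := h2
            _ ≤ K * ‖u s‖ := mul_le_mul_of_nonneg_right
                ((le_abs_self L).trans (le_max_right _ _)) (norm_nonneg _)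
            _ ≤ _ := mul_le_mul_of_nonneg_left (le_max_left _ _) hK0)
      t ⟨hr.2.le, le_rfl⟩
    rw [gronwallBound_ε0] at h
    calc ‖u t‖ ≤ ‖(u t, u₁ t)‖ := le_max_left _ _
      _ ≤ _ := h
      _ ≤ _ := by
        refine mul_le_mul_of_nonneg_left (Real.exp_le_exp.2 ?_) (norm_nonneg _)
        exact mul_le_mul_of_nonneg_left (by linarith [hr.1]) hK0
  have hl : Filter.Tendsto (fun r => ‖(u r, u₁ r)‖ * Real.exp (K * (t - a)))
      (nhdsWithin a (Ioi a)) (nhds (‖((0, 0) : E × E)‖ * Real.exp (K * (t - a)))) :=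
    ((hlim.prodMk_nhds hlim₁).norm).mul_const _
  have := ge_of_tendsto hl (by
    filter_upwards [Ioo_mem_nhdsGT ht.1] with r hr using hmain r hr)
  simpa using this

variable {F : ℝ → ℝ} {ψ : ℝ × ℝ → ℝ}

theorem tendsto_nhdsGT_of_continuousOn_Icc {E : Type*} [TopologicalSpace E] {u : ℝ → E} {a b : ℝ}
    (hab : a < b) (hu : ContinuousOn u (Icc a b)) :
    Filter.Tendsto u (nhdsWithin a (Ioi a)) (nhds (u a)) :=
  (hu a (left_mem_Icc.2 hab.le)).mono_left (nhdsWithin_le_of_mem (Icc_mem_nhdsGT hab))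

theorem IsBaseFlow.continuousOn_slice (hψ : IsBaseFlow F ψ) (x : ℝ) :
    ContinuousOn (fun t => ψ (x, t)) (Icc (-1) 1) :=
  hψ.contDiffOn_closed.continuousOn.comp (by fun_prop) (fun _ ht => mem_closedStrip.2 ht)

/-! ### Wall velocities and evenness of the profile -/

/-- Conservation of energy: the wall velocities agree up to sign. -/
theorem IsBaseFlow.dy_sq_eq (hF : ContDiff ℝ 1 F) (hψ : IsBaseFlow F ψ)
    (hnd : Nondegenerate F ψ) (x : ℝ) : dy ψ x 1 ^ 2 = dy ψ x (-1) ^ 2 := by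
  have hG : ∀ s, HasDerivAt (fun s => ∫ r in (0 : ℝ)..s, F r) (F s) s := fun s =>
    (hF.continuous.integral_hasStrictDerivAt 0 s).hasDerivAt
  have hGc : Continuous (fun s => ∫ r in (0 : ℝ)..s, F r) :=
    continuous_iff_continuousAt.2 fun s => (hG s).continuousAt
  -- Mean value theorem for the energy, whose derivative `2ψ'(ψ'' - F(ψ))` vanishes; the potential
  -- terms at the two walls agree because `ψ = 0` there.
  obtain ⟨c, -, hc⟩ := exists_hasDerivAt_eq_slope
    (fun t => dy ψ x t ^ 2 - 2 * ∫ r in (0 : ℝ)..ψ (x, t), F r) (fun _ => 0)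
    (a := -1) (b := 1) (by norm_num)
    (((hψ.continuousOn_dy hF x).pow 2).sub
      ((hGc.comp_continuousOn (hψ.continuousOn_slice x)).const_smul (2 : ℝ)))
    (fun t ht => by
      have h1 := (hψ.hasDerivAt_dy hF hnd x ht).pow 2
      have h2 := ((hG (ψ (x, t))).comp t (hψ.hasDerivAt_snd x ht)).const_mul 2
      refine (h1.sub h2).congr_deriv ?_
      norm_num
      ring)
  rw [hψ.top, hψ.bottom] at hc
  norm_num at hc
  linarith

/-- If one wall velocity vanished, so would the other by energy conservation; then `∂_yψ` would be a
linearized solution with zero data, hence zero, and `ψ` would be constant in `y`. -/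
theorem IsBaseFlow.dy_one_ne_zero (hF : ContDiff ℝ 1 F) (hψ : IsBaseFlow F ψ)
    (hnd : Nondegenerate F ψ) (hne : ∃ p ∈ closedStrip, ψ p ≠ 0) (x : ℝ) : dy ψ x 1 ≠ 0 := by
  intro h0
  have h0' : dy ψ x (-1) = 0 := by
    have := hψ.dy_sq_eq hF hnd x
    rw [h0] at this
    simpa using this.symm
  have hz := hnd _ (isLinearizedSolution_fderivWithin hF hψ (0, 1))
    (fun x' => by
      rw [← hψ.dy_eq x' (by norm_num), hψ.dy_eq_of_nondegenerate hF hnd x' x (by norm_num), h0])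
    (fun x' => by
      rw [← hψ.dy_eq x' (by norm_num), hψ.dy_eq_of_nondegenerate hF hnd x' x (by norm_num), h0'])
  obtain ⟨⟨a, b⟩, hp, hab⟩ := hne
  rw [mem_closedStrip] at hp
  refine hab ?_
  rw [← hψ.bottom a]
  refine constant_of_derivWithin_zero (f := fun t => ψ (a, t)) (a := -1) (b := 1)
    (fun t ht => (hψ.hasDerivWithinAt_dy a ht).differentiableWithinAt) (fun t ht => ?_) b hp
  have ht' := Ico_subset_Icc_self ht
  change dy ψ a t = 0
  rw [hψ.dy_eq a ht']
  exact hz _ (mem_closedStrip.2 ht')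

theorem IsBaseFlow.dy_neg_one (hF : ContDiff ℝ 1 F) (hψ : IsBaseFlow F ψ)
    (hnd : Nondegenerate F ψ) {x : ℝ} (hside : dy ψ x 1 * dy ψ x (-1) ≤ 0) :
    dy ψ x (-1) = -dy ψ x 1 := by
  rcases sq_eq_sq_iff_eq_or_eq_neg.1 (hψ.dy_sq_eq hF hnd x) with h | h
  -- With equal velocities, the sign hypothesis says that a square is nonpositive, so both vanish.
  · rw [h] at hside ⊢
    have : dy ψ x (-1) = 0 := mul_self_eq_zero.1 (le_antisymm hside (mul_self_nonneg _))
    rw [this, neg_zero]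
  · rw [h, neg_neg]

/-- Opposite wall velocities force the profile to be even. -/
theorem IsBaseFlow.even (hF : ContDiff ℝ 1 F) (hψ : IsBaseFlow F ψ)
    (hnd : Nondegenerate F ψ) {x : ℝ} (hside : dy ψ x 1 * dy ψ x (-1) ≤ 0) {y : ℝ}
    (hy : y ∈ Icc (-1 : ℝ) 1) : ψ (x, -y) = ψ (x, y) := by
  have hIcc : ∀ t ∈ Icc (-1 : ℝ) 1, -t ∈ Icc (-1 : ℝ) 1 := fun t ht =>
    ⟨by linarith [ht.2], by linarith [ht.1]⟩
  have hIoo : ∀ t ∈ Ioo (-1 : ℝ) 1, -t ∈ Ioo (-1 : ℝ) 1 := fun t ht =>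
    ⟨by linarith [ht.2], by linarith [ht.1]⟩
  have hψc := hψ.continuousOn_slice x
  have hdc := hψ.continuousOn_dy hF x
  obtain ⟨M, hM⟩ := isCompact_Icc.exists_bound_of_continuousOn hψc
  obtain ⟨L, hL⟩ := (isCompact_Icc (a := -M) (b := M)).exists_bound_of_continuousOn
    (hF.continuous_deriv (by norm_num)).continuousOn
  have hmem : ∀ t ∈ Icc (-1 : ℝ) 1, ψ (x, t) ∈ Icc (-M) M := fun t ht => abs_le.1 (hM t ht)
  -- The odd difference `u(t) = ψ(t) - ψ(-t)` has zero Cauchy data at `t = -1`: `ψ` vanishes on both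
  -- walls and the wall velocities are opposite. `L` bounds `F'` on the range of `ψ`.
  have h0 := eq_zero_of_norm_deriv_deriv_le (a := -1) (b := 1) (L := L)
    (u := fun t => ψ (x, t) - ψ (x, -t)) (u₁ := fun t => dy ψ x t + dy ψ x (-t))
    (u₂ := fun t => F (ψ (x, t)) - F (ψ (x, -t)))
    (fun t ht => by
      have h2 := (hψ.hasDerivAt_snd x (hIoo t ht)).comp t (hasDerivAt_neg t)
      refine ((hψ.hasDerivAt_snd x ht).sub h2).congr_deriv (by ring))
    (fun t ht => by
      have h2 := (hψ.hasDerivAt_dy hF hnd x (hIoo t ht)).comp t (hasDerivAt_neg t)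
      refine ((hψ.hasDerivAt_dy hF hnd x ht).add h2).congr_deriv (by ring))
    (fun t ht => by
      have ht' := Ioo_subset_Icc_self ht
      exact Convex.norm_image_sub_le_of_norm_deriv_le
        (fun s _ => hF.differentiable (by norm_num) s) hL (convex_Icc _ _)
        (hmem _ (hIcc t ht')) (hmem t ht'))
    (by
      have := tendsto_nhdsGT_of_continuousOn_Icc (u := fun t => ψ (x, t) - ψ (x, -t))
        (by norm_num) (hψc.sub (hψc.comp (f := fun t => -t) (by fun_prop) hIcc))
      simpa [hψ.top, hψ.bottom] using this)
    (by
      have := tendsto_nhdsGT_of_continuousOn_Icc (u := fun t => dy ψ x t + dy ψ x (-t))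
        (by norm_num) (hdc.add (hdc.comp (f := fun t => -t) (by fun_prop) hIcc))
      simpa [hψ.dy_neg_one hF hnd hside] using this)
  rcases eq_or_lt_of_le hy.1 with h | h
  · rw [← h, neg_neg, hψ.top, hψ.bottom]
  rcases eq_or_lt_of_le hy.2 with h' | h'
  · rw [h', hψ.top, hψ.bottom]
  exact (sub_eq_zero.1 (h0 y ⟨h, h'⟩)).symm

/-! ### Fourier modes and unique continuation from the axis -/

theorem continuous_slice_fst {u : ℝ × ℝ → ℝ} (hu : ContinuousOn u openStrip) {y : ℝ}
    (hy : y ∈ Ioo (-1 : ℝ) 1) : Continuous fun x => u (x, y) :=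
  hu.comp_continuous (by fun_prop) fun _ => mem_openStrip.2 hy

theorem hasDerivAt_integral_mul {u : ℝ × ℝ → ℝ} (hu : ContDiffOn ℝ 1 u openStrip) {e : ℝ → ℝ}
    (he : Continuous e) (a b : ℝ) {y : ℝ} (hy : y ∈ Ioo (-1 : ℝ) 1) :
    HasDerivAt (fun t => ∫ x in a..b, e x * u (x, t))
      (∫ x in a..b, e x * dirDeriv (0, 1) u (x, y)) y := by
  have hd : ContinuousOn (dirDeriv (0, 1) u) openStrip :=
    (contDiffOn_dirDeriv (m := 0) (0, 1) hu (by norm_num)).continuousOn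
  -- A compact neighbourhood of `y`, reaching halfway to each wall, on which `∂_y u` is bounded.
  set J := Icc ((-1 + y) / 2) ((1 + y) / 2)
  have hJy : J ∈ nhds y := Icc_mem_nhds (by linarith [hy.1]) (by linarith [hy.2])
  have hJsub : J ⊆ Ioo (-1 : ℝ) 1 := fun t ht =>
    ⟨by linarith [hy.1, ht.1], by linarith [hy.2, ht.2]⟩
  obtain ⟨C, hC⟩ := (isCompact_uIcc (a := a) (b := b)).prod (isCompact_Icc (a := (-1 + y) / 2)
    (b := (1 + y) / 2)) |>.exists_bound_of_continuousOn
    (f := fun p : ℝ × ℝ => e p.1 * dirDeriv (0, 1) u p)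
    ((he.comp continuous_fst).continuousOn.mul
      (hd.mono fun p hp => mem_openStrip.2 (hJsub hp.2)))
  have hcont : ∀ t ∈ Ioo (-1 : ℝ) 1, Continuous fun x => e x * u (x, t) := fun t ht =>
    he.mul (continuous_slice_fst hu.continuousOn ht)
  refine (intervalIntegral.hasDerivAt_integral_of_dominated_loc_of_deriv_le
    (F := fun t x => e x * u (x, t)) (F' := fun t x => e x * dirDeriv (0, 1) u (x, t))
    (bound := fun _ => C) hJy ?_ ((hcont y hy).intervalIntegrable _ _)
    (he.mul (continuous_slice_fst hd hy)).aestronglyMeasurable ?_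
    intervalIntegrable_const ?_).2
  · filter_upwards [hJy] with t ht using (hcont t (hJsub ht)).aestronglyMeasurable
  · exact Filter.Eventually.of_forall fun x hx t ht =>
      hC (x, t) ⟨uIoc_subset_uIcc hx, ht⟩
  · exact Filter.Eventually.of_forall fun x _ t ht =>
      (hasDerivAt_slice_snd hu (hJsub ht)).const_mul (e x)

/-- Two integrations by parts over a period, with boundary terms cancelling by periodicity, turn
`∂ₓ²` into multiplication by `-κ` on the mode `e`. -/
theorem integral_mul_dirDeriv_dirDeriv {w : ℝ × ℝ → ℝ} (hw : ContDiffOn ℝ 2 w openStrip)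
    (hper : XPeriodic w) {e e₁ : ℝ → ℝ} {κ : ℝ} (he : ∀ x, HasDerivAt e (e₁ x) x)
    (he₁ : ∀ x, HasDerivAt e₁ (-κ * e x) x) (hep : Function.Periodic e (2 * Real.pi))
    (hep₁ : Function.Periodic e₁ (2 * Real.pi)) {y : ℝ} (hy : y ∈ Ioo (-1 : ℝ) 1) :
    ∫ x in (0 : ℝ)..2 * Real.pi, e x * dirDeriv (1, 0) (dirDeriv (1, 0) w) (x, y)
      = -κ * ∫ x in (0 : ℝ)..2 * Real.pi, e x * w (x, y) := by
  have hw1 : ContDiffOn ℝ 1 w openStrip := hw.of_le (by norm_num)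
  have hd1 : ContDiffOn ℝ 1 (dirDeriv (1, 0) w) openStrip :=
    contDiffOn_dirDeriv _ hw (by norm_num)
  have hd2 : ContDiffOn ℝ 0 (dirDeriv (1, 0) (dirDeriv (1, 0) w)) openStrip :=
    contDiffOn_dirDeriv _ hd1 (by norm_num)
  have hec : Continuous e := continuous_iff_continuousAt.2 fun x => (he x).continuousAt
  have hec₁ : Continuous e₁ := continuous_iff_continuousAt.2 fun x => (he₁ x).continuousAt
  have hwp : w (2 * Real.pi, y) = w (0, y) := by
    simpa using hper 0 y (Ioo_subset_Icc_self hy)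
  have hdp : dirDeriv (1, 0) w (2 * Real.pi, y) = dirDeriv (1, 0) w (0, y) := by
    rw [← (hasDerivAt_slice_fst hw1 (x := 2 * Real.pi) hy).deriv,
      ← (hasDerivAt_slice_fst hw1 (x := 0) hy).deriv]
    have h := deriv_comp_add_const (fun s => w (s, y)) (2 * Real.pi) 0
    rw [zero_add] at h
    rw [← h]
    congr 1
    exact funext fun s => hper s y (Ioo_subset_Icc_self hy)
  have h1 := intervalIntegral.integral_mul_deriv_eq_deriv_mul (a := 0) (b := 2 * Real.pi)
    (fun x _ => he x) (fun x _ => hasDerivAt_slice_fst hd1 (x := x) hy)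
    (hec₁.intervalIntegrable _ _)
    ((continuous_slice_fst hd2.continuousOn hy).intervalIntegrable _ _)
  have h2 := intervalIntegral.integral_mul_deriv_eq_deriv_mul (a := 0) (b := 2 * Real.pi)
    (fun x _ => he₁ x) (fun x _ => hasDerivAt_slice_fst hw1 (x := x) hy)
    ((hec.const_mul _).intervalIntegrable _ _)
    ((continuous_slice_fst hd1.continuousOn hy).intervalIntegrable _ _)
  rw [h1, h2, hwp, hdp, hep.eq, hep₁.eq]
  simp only [mul_assoc, intervalIntegral.integral_const_mul]
  ring

/-- Unique continuation for a single Fourier mode: zero Cauchy data on the axis of the channel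
force the modes of the trace on the upper wall to vanish. -/
theorem IsLinearizedSolution.integral_mul_top_eq_zero {F : ℝ → ℝ} {ψ w : ℝ × ℝ → ℝ}
    (hF : ContDiff ℝ 1 F) (hψ : IsBaseFlow F ψ) (hnd : Nondegenerate F ψ)
    (hw : IsLinearizedSolution F ψ w) (hw0 : ∀ x, w (x, 0) = 0)
    (hw1 : ∀ x, dirDeriv (0, 1) w (x, 0) = 0) {e e₁ : ℝ → ℝ} {κ : ℝ}
    (he : ∀ x, HasDerivAt e (e₁ x) x) (he₁ : ∀ x, HasDerivAt e₁ (-κ * e x) x)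
    (hep : Function.Periodic e (2 * Real.pi)) (hep₁ : Function.Periodic e₁ (2 * Real.pi)) :
    ∫ x in (0 : ℝ)..2 * Real.pi, e x * w (x, 1) = 0 := by
  have hec : Continuous e := continuous_iff_continuousAt.2 fun x => (he x).continuousAt
  have hc2 := hw.contDiffOn
  have hc1 : ContDiffOn ℝ 1 w openStrip := hc2.of_le (by norm_num)
  have hd1 : ContDiffOn ℝ 1 (dirDeriv (0, 1) w) openStrip :=
    contDiffOn_dirDeriv _ hc2 (by norm_num)
  have hxx : ContDiffOn ℝ 0 (dirDeriv (1, 0) (dirDeriv (1, 0) w)) openStrip :=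
    contDiffOn_dirDeriv _ (contDiffOn_dirDeriv (m := 1) _ hc2 (by norm_num)) (by norm_num)
  obtain ⟨M, hM⟩ := isCompact_Icc.exists_bound_of_continuousOn
    ((hF.continuous_deriv (by norm_num)).comp_continuousOn (hψ.continuousOn_slice 0))
  have hsub : Ioo (0 : ℝ) 1 ⊆ Ioo (-1 : ℝ) 1 := Ioo_subset_Ioo_left (by norm_num)
  have h0 : (0 : ℝ) ∈ Ioo (-1 : ℝ) 1 := by norm_num
  have hzero : ∀ t ∈ Ioo (0 : ℝ) 1, ∫ x in (0 : ℝ)..2 * Real.pi, e x * w (x, t) = 0 := by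
    refine eq_zero_of_norm_deriv_deriv_le (L := M + |κ|)
      (fun t ht => hasDerivAt_integral_mul hc1 hec 0 (2 * Real.pi) (hsub ht))
      (fun t ht => hasDerivAt_integral_mul hd1 hec 0 (2 * Real.pi) (hsub ht))
      (fun t ht => ?_) ?_ ?_
    · have ht' := hsub ht
      -- Because the flow is a shear, the coefficient `F'(ψ)` can be read at `x = 0` and leaves the
      -- integral, so the mode satisfies a closed ODE.
      have heq : ∀ x, e x * dirDeriv (0, 1) (dirDeriv (0, 1) w) (x, t)
          = deriv F (ψ (0, t)) * (e x * w (x, t))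
            - e x * dirDeriv (1, 0) (dirDeriv (1, 0) w) (x, t) := by
        intro x
        have h := hw.equation x t ht'
        rw [lap_eq hc2 ht', hψ.eq_of_nondegenerate hF hnd x 0 (Ioo_subset_Icc_self ht')] at h
        linear_combination e x * h
      have hI₁ : Continuous fun x => deriv F (ψ (0, t)) * (e x * w (x, t)) :=
        continuous_const.mul (hec.mul (continuous_slice_fst hc1.continuousOn ht'))
      have hI₂ : Continuous fun x => e x * dirDeriv (1, 0) (dirDeriv (1, 0) w) (x, t) :=
        hec.mul (continuous_slice_fst hxx.continuousOn ht')
      simp only [heq]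
      rw [intervalIntegral.integral_sub (hI₁.intervalIntegrable _ _) (hI₂.intervalIntegrable _ _),
        intervalIntegral.integral_const_mul,
        integral_mul_dirDeriv_dirDeriv hc2 hw.periodic he he₁ hep hep₁ ht', neg_mul,
        sub_neg_eq_add, ← add_mul, norm_mul]
      refine mul_le_mul_of_nonneg_right ((norm_add_le _ _).trans ?_) (norm_nonneg _)
      exact add_le_add_left (hM t (Ioo_subset_Icc_self ht')) _
    · have h := (hasDerivAt_integral_mul hc1 hec 0 (2 * Real.pi) h0).continuousAt
      have h' : Filter.Tendsto _ _ _ := h.continuousWithinAt (s := Ioi 0)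
      simpa [hw0] using h'
    · have h := (hasDerivAt_integral_mul hd1 hec 0 (2 * Real.pi) h0).continuousAt
      have h' : Filter.Tendsto _ _ _ := h.continuousWithinAt (s := Ioi 0)
      simpa [hw1] using h'
  -- Nothing is known about `w` off the closed strip. Clamping `t` to `[-1, 1]` gives a globally
  -- continuous function, so the vanishing on `(0, 1)` passes to `t = 1`.
  have hcont : Continuous fun t : ℝ =>
      ∫ x in (0 : ℝ)..2 * Real.pi, e x * w (x, max (-1) (min t 1)) := by
    refine intervalIntegral.continuous_parametric_intervalIntegral_of_continuous' ?_ _ _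
    refine (hec.comp continuous_snd).mul (hw.continuousOn.comp_continuous
      (f := fun p : ℝ × ℝ => (p.2, max (-1) (min p.1 1))) (by fun_prop) fun p => ?_)
    exact mem_closedStrip.2 ⟨le_max_left _ _, max_le (by norm_num) (min_le_right _ _)⟩
  have hext : EqOn (fun t : ℝ => ∫ x in (0 : ℝ)..2 * Real.pi, e x * w (x, max (-1) (min t 1)))
      (fun _ => 0) (Ioo 0 1) := fun t ht => by
    have : max (-1) (min t 1) = t := by
      rw [min_eq_left ht.2.le, max_eq_right (by linarith [ht.1])]
    simpa only [this] using hzero t ht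
  have h1 := hext.closure hcont continuous_const
  rw [closure_Ioo (by norm_num)] at h1
  simpa using h1 (right_mem_Icc.2 (zero_le_one' ℝ))

/-- A continuous periodic function is determined by its trigonometric moments. -/
theorem eq_zero_of_trigonometric_moments {f : ℝ → ℝ} (hf : Continuous f)
    (hper : Function.Periodic f (2 * Real.pi))
    (hcos : ∀ n : ℤ, ∫ x in (0 : ℝ)..2 * Real.pi, Real.cos (n * x) * f x = 0)
    (hsin : ∀ n : ℤ, ∫ x in (0 : ℝ)..2 * Real.pi, Real.sin (n * x) * f x = 0) (x : ℝ) :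
    f x = 0 := by
  have : Fact (0 < 2 * Real.pi) := ⟨Real.two_pi_pos⟩
  have hperc : Function.Periodic (fun x => (f x : ℂ)) (2 * Real.pi) := fun x => by
    simp only [hper x]
  let G : C(AddCircle (2 * Real.pi), ℂ) :=
    ⟨hperc.lift, continuous_coinduced_dom.2 (Complex.continuous_ofReal.comp hf)⟩
  have hG : ∀ x : ℝ, G (x : AddCircle (2 * Real.pi)) = f x := fun x => hperc.lift_coe x
  have hcoef : fourierCoeff G = 0 := by
    funext n
    rw [fourierCoeff_eq_intervalIntegral _ n 0, zero_add]
    have hpt : ∀ x : ℝ, (fourier (-n)) (x : AddCircle (2 * Real.pi)) • G x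
        = ((Real.cos (n * x) * f x : ℝ) : ℂ) - ((Real.sin (n * x) * f x : ℝ) : ℂ) * Complex.I := by
      intro x
      rw [fourier_coe_apply, hG, smul_eq_mul]
      have : 2 * (Real.pi : ℂ) * Complex.I * ((-n : ℤ) : ℂ) * x / ((2 * Real.pi : ℝ) : ℂ)
          = ((-(n * x) : ℝ) : ℂ) * Complex.I := by
        have : (Real.pi : ℂ) ≠ 0 := by exact_mod_cast Real.pi_ne_zero
        push_cast
        field_simp
      rw [this, Complex.exp_mul_I, ← Complex.ofReal_cos, ← Complex.ofReal_sin, Real.cos_neg,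
        Real.sin_neg]
      push_cast
      ring
    have hc : Continuous fun x => ((Real.cos (n * x) * f x : ℝ) : ℂ) := by fun_prop
    have hs : Continuous fun x => ((Real.sin (n * x) * f x : ℝ) : ℂ) * Complex.I := by fun_prop
    simp only [hpt]
    rw [intervalIntegral.integral_sub (hc.intervalIntegrable _ _) (hs.intervalIntegrable _ _),
      intervalIntegral.integral_mul_const, intervalIntegral.integral_ofReal,
      intervalIntegral.integral_ofReal, hcos, hsin]
    simp
  -- All coefficients vanish, so the Fourier series is summable and converges pointwise to `G`, with
  -- sum zero.
  have hs := has_pointwise_sum_fourier_series_of_summable (f := G)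
    (by rw [hcoef]; exact summable_zero) x
  rw [hcoef, hG] at hs
  simp only [Pi.zero_apply, zero_smul] at hs
  exact_mod_cast hs.unique hasSum_zero

theorem IsLinearizedSolution.top_eq_zero {F : ℝ → ℝ} {ψ w : ℝ × ℝ → ℝ}
    (hF : ContDiff ℝ 1 F) (hψ : IsBaseFlow F ψ) (hnd : Nondegenerate F ψ)
    (hw : IsLinearizedSolution F ψ w) (hw0 : ∀ x, w (x, 0) = 0)
    (hw1 : ∀ x, dirDeriv (0, 1) w (x, 0) = 0) (x : ℝ) : w (x, 1) = 0 := by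
  have hlin : ∀ (n : ℤ) (x : ℝ), HasDerivAt (fun x => (n : ℝ) * x) n x := fun n x => by
    simpa using (hasDerivAt_id x).const_mul (n : ℝ)
  have hshift : ∀ (n : ℤ) (x : ℝ), (n : ℝ) * (x + 2 * Real.pi) = n * x + n * (2 * Real.pi) :=
    fun n x => by ring
  have hcp : ∀ n : ℤ, Function.Periodic (fun x => Real.cos (n * x)) (2 * Real.pi) := fun n x => by
    simp only [hshift, Real.cos_add_int_mul_two_pi]
  have hsp : ∀ n : ℤ, Function.Periodic (fun x => Real.sin (n * x)) (2 * Real.pi) := fun n x => by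
    simp only [hshift, Real.sin_add_int_mul_two_pi]
  refine eq_zero_of_trigonometric_moments (f := fun x => w (x, 1))
    (hw.continuousOn.comp_continuous (by fun_prop) fun _ => mem_closedStrip.2 (by norm_num))
    (fun x => hw.periodic x 1 (by norm_num)) (fun n => ?_) (fun n => ?_) x
  · refine hw.integral_mul_top_eq_zero hF hψ hnd hw0 hw1 (κ := (n : ℝ) ^ 2)
      (e := fun x => Real.cos (n * x)) (e₁ := fun x => -n * Real.sin (n * x))
      (fun x => ((hlin n x).cos).congr_deriv (by ring))
      (fun x => (((hlin n x).sin).const_mul (-n : ℝ)).congr_deriv (by ring)) (hcp n)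
      (fun x => by simp only [hsp n x])
  · refine hw.integral_mul_top_eq_zero hF hψ hnd hw0 hw1 (κ := (n : ℝ) ^ 2)
      (e := fun x => Real.sin (n * x)) (e₁ := fun x => n * Real.cos (n * x))
      (fun x => ((hlin n x).sin).congr_deriv (by ring))
      (fun x => (((hlin n x).cos).const_mul (n : ℝ)).congr_deriv (by ring)) (hsp n)
      (fun x => by simp only [hcp n x])

/-! ### Linearity and symmetries of the linearized equation -/

variable {u w : ℝ × ℝ → ℝ}

theorem contDiffAt_slice_fst {n : WithTop ℕ∞} (hu : ContDiffOn ℝ n u openStrip) (x : ℝ) {y : ℝ}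
    (hy : y ∈ Ioo (-1 : ℝ) 1) : ContDiffAt ℝ n (fun s => u (s, y)) x :=
  (hu.contDiffAt (isOpen_openStrip.mem_nhds (mem_openStrip (x := x).2 hy))).comp x
    (contDiffAt_id.prodMk contDiffAt_const)

theorem contDiffAt_slice_snd {n : WithTop ℕ∞} (hu : ContDiffOn ℝ n u openStrip) (x : ℝ) {y : ℝ}
    (hy : y ∈ Ioo (-1 : ℝ) 1) : ContDiffAt ℝ n (fun t => u (x, t)) y :=
  (hu.contDiffAt (isOpen_openStrip.mem_nhds (mem_openStrip (x := x).2 hy))).comp y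
    (contDiffAt_const.prodMk contDiffAt_id)

theorem IsLinearizedSolution.add (hu : IsLinearizedSolution F ψ u)
    (hw : IsLinearizedSolution F ψ w) : IsLinearizedSolution F ψ (fun p => u p + w p) where
  periodic x y hy := by simp only [hu.periodic x y hy, hw.periodic x y hy]
  contDiffOn := hu.contDiffOn.add hw.contDiffOn
  continuousOn := hu.continuousOn.add hw.continuousOn
  equation x y hy := by
    have h1 := iteratedDeriv_fun_add (n := 2) (contDiffAt_slice_fst hu.contDiffOn x hy)
      (contDiffAt_slice_fst hw.contDiffOn x hy)
    have h2 := iteratedDeriv_fun_add (n := 2) (contDiffAt_slice_snd hu.contDiffOn x hy)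
      (contDiffAt_slice_snd hw.contDiffOn x hy)
    have h3 := hu.equation x y hy
    have h4 := hw.equation x y hy
    simp only [lap] at h3 h4 ⊢
    rw [h1, h2]
    linear_combination h3 + h4

theorem IsLinearizedSolution.sub (hu : IsLinearizedSolution F ψ u)
    (hw : IsLinearizedSolution F ψ w) : IsLinearizedSolution F ψ (fun p => u p - w p) where
  periodic x y hy := by simp only [hu.periodic x y hy, hw.periodic x y hy]
  contDiffOn := hu.contDiffOn.sub hw.contDiffOn
  continuousOn := hu.continuousOn.sub hw.continuousOn
  equation x y hy := by
    have h1 := iteratedDeriv_fun_sub (n := 2) (contDiffAt_slice_fst hu.contDiffOn x hy)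
      (contDiffAt_slice_fst hw.contDiffOn x hy)
    have h2 := iteratedDeriv_fun_sub (n := 2) (contDiffAt_slice_snd hu.contDiffOn x hy)
      (contDiffAt_slice_snd hw.contDiffOn x hy)
    have h3 := hu.equation x y hy
    have h4 := hw.equation x y hy
    simp only [lap] at h3 h4 ⊢
    rw [h1, h2]
    linear_combination h3 - h4

theorem IsLinearizedSolution.translate (hu : IsLinearizedSolution F ψ u) {s : ℝ}
    (hψ : ∀ x, ∀ y ∈ Icc (-1 : ℝ) 1, ψ (x + s, y) = ψ (x, y)) :
    IsLinearizedSolution F ψ (fun p => u (p.1 + s, p.2)) where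
  periodic x y hy := by
    simp only [← hu.periodic (x + s) y hy, add_right_comm]
  contDiffOn := hu.contDiffOn.comp (f := fun p : ℝ × ℝ => (p.1 + s, p.2)) (by fun_prop)
    fun _ hp => ⟨mem_univ _, hp.2⟩
  continuousOn := hu.continuousOn.comp (f := fun p : ℝ × ℝ => (p.1 + s, p.2)) (by fun_prop)
    fun _ hp => ⟨mem_univ _, hp.2⟩
  equation x y hy := by
    have h := hu.equation (x + s) y hy
    rw [hψ x y (Ioo_subset_Icc_self hy)] at h
    have h1 := congrFun (iteratedDeriv_comp_add_const 2 (fun z => u (z, y)) s) x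
    simp only [lap] at h ⊢
    rw [h1]
    exact h

theorem IsLinearizedSolution.reflect (hu : IsLinearizedSolution F ψ u)
    (hψ : ∀ x, ∀ y ∈ Icc (-1 : ℝ) 1, ψ (x, -y) = ψ (x, y)) :
    IsLinearizedSolution F ψ (fun p => u (p.1, -p.2)) where
  periodic x y hy := hu.periodic x (-y) ⟨by linarith [hy.2], by linarith [hy.1]⟩
  contDiffOn := hu.contDiffOn.comp (f := fun p : ℝ × ℝ => (p.1, -p.2)) (by fun_prop)
    fun _ hp => ⟨mem_univ _, by linarith [hp.2.2], by linarith [hp.2.1]⟩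
  continuousOn := hu.continuousOn.comp (f := fun p : ℝ × ℝ => (p.1, -p.2)) (by fun_prop)
    fun _ hp => ⟨mem_univ _, by linarith [hp.2.2], by linarith [hp.2.1]⟩
  equation x y hy := by
    have h := hu.equation x (-y) ⟨by linarith [hy.2], by linarith [hy.1]⟩
    rw [hψ x y (Ioo_subset_Icc_self hy)] at h
    have h1 := iteratedDeriv_comp_neg 2 (fun t => u (x, t)) y
    simp only [lap] at h ⊢
    rw [h1]
    simpa using h

end FlatChannel

/-! ### The equivalence -/

open FlatChannel in
/-- Here `g` and `h` are the outward displacements of the two walls: the deformed channel is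
`{-1 - ε g(x) ≤ y ≤ 1 + ε h(x)}`. The hypothesis `hside` says that the velocities of the base flow
on the two walls do not point in the same direction; it holds whenever `ψ₀` has a sign. -/
theorem lemma3p1
    (α : NNReal) (hα0 : 0 < α) (hα1 : α < 1)
    (F : ℝ → ℝ) (hF : ContDiff ℝ 4 F)
    (ψ₀ : ℝ × ℝ → ℝ) (hψ₀ : FlatChannel.IsBaseFlow F ψ₀)
    (hne : ∃ p ∈ FlatChannel.closedStrip, ψ₀ p ≠ 0)
    (hnd : FlatChannel.Nondegenerate F ψ₀)
    (hside : ∀ x : ℝ, FlatChannel.dy ψ₀ x 1 * FlatChannel.dy ψ₀ x (-1) ≤ 0)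
    (g h : ℝ → ℝ) (hg : FlatChannel.HolderTwo α g) (hh : FlatChannel.HolderTwo α h)
    (φ : ℝ × ℝ → ℝ)
    (hφ : FlatChannel.IsFirstOrderCorrection F ψ₀ (fun x => -g x) h φ) :
    (∃ x : ℝ, deriv (fun s : ℝ => φ (s, 0)) x ≠ 0) ↔
      (∃ x : ℝ, deriv h x + deriv g x ≠ 0) := by
  have hF1 : ContDiff ℝ 1 F := hF.of_le (by norm_num)
  have h00 : (0 : ℝ) ∈ Ioo (-1 : ℝ) 1 := by norm_num
  have h11 : (1 : ℝ) ∈ Icc (-1 : ℝ) 1 := by norm_num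
  set c := dy ψ₀ 0 1
  have hc0 : c ≠ 0 := hψ₀.dy_one_ne_zero hF1 hnd hne 0
  have htop : ∀ x, dy ψ₀ x 1 = c := fun x => hψ₀.dy_eq_of_nondegenerate hF1 hnd x 0 h11
  have hbot : ∀ x, dy ψ₀ x (-1) = -c := fun x => by
    rw [hψ₀.dy_neg_one hF1 hnd (hside x), htop]
  -- The even part of `φ`, translated by `s`, minus itself: this one solution serves both
  -- directions.
  have hsol : ∀ s, IsLinearizedSolution F ψ₀
      (fun p => (φ (p.1 + s, p.2) + φ (p.1 + s, -p.2)) - (φ p + φ (p.1, -p.2))) := fun s => by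
    have hev := hφ.solution.add (hφ.solution.reflect fun x y hy => hψ₀.even hF1 hnd (hside x) hy)
    exact (hev.translate fun x y hy =>
      hψ₀.eq_of_nondegenerate hF1 hnd (x + s) x hy).sub hev
  have hwall : ∀ x, φ (x, 1) + φ (x, -1) = -c * (h x + g x) := fun x => by
    rw [hφ.top, hφ.bottom, htop, hbot]
    ring
  have hdφ : ∀ x, DifferentiableAt ℝ (fun s => φ (s, 0)) x := fun x =>
    (contDiffAt_slice_fst hφ.solution.contDiffOn x h00).differentiableAt (by norm_num)
  have hdg : Differentiable ℝ g := hg.2.1.differentiable (by norm_num)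
  have hdh : Differentiable ℝ h := hh.2.1.differentiable (by norm_num)
  have hdsum : ∀ x, deriv (fun s => h s + g s) x = deriv h x + deriv g x := fun x =>
    deriv_fun_add (hdh x) (hdg x)
  rw [← not_iff_not]
  push Not
  constructor
  · intro hx0 x
    have hconst : ∀ a b, φ (a, 0) = φ (b, 0) := is_const_of_deriv_eq_zero hdφ hx0
    have hsum : ∀ s, h s + g s = h 0 + g 0 := fun s => by
      have hz := (hsol s).top_eq_zero hF1 hψ₀ hnd
        (fun x => by
          simp only [neg_zero]
          rw [hconst (x + s) x, sub_self])
        (fun x => by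
          rw [← (hasDerivAt_slice_snd ((hsol s).contDiffOn.of_le (by norm_num)) (x := x)
            h00).deriv]
          -- `f` is even, so its derivative at `0` equals its own negative.
          set f : ℝ → ℝ := fun t => φ (x + s, t) + φ (x + s, -t) - (φ (x, t) + φ (x, -t)) with hf
          have hfe : (fun t => f (-t)) = f := by
            funext t
            simp only [hf, neg_neg]
            ring
          have h1 := deriv_comp_neg f 0
          rw [hfe, neg_zero] at h1
          linarith)
        0
      simp only [zero_add, hwall] at hz
      have : -c * ((h s + g s) - (h 0 + g 0)) = 0 := by linarith
      rcases mul_eq_zero.1 this with h2 | h2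
      · exact absurd (neg_eq_zero.1 h2) hc0
      · linarith
    rw [← hdsum, show (fun s => h s + g s) = fun _ => h 0 + g 0 from funext hsum, deriv_const]
  · intro hx0 x
    have hconst : ∀ a b, h a + g a = h b + g b :=
      is_const_of_deriv_eq_zero (f := fun s => h s + g s) (hdh.add hdg)
        fun s => (hdsum s).trans (hx0 s)
    have heq : ∀ s, φ (s, 0) = φ (0, 0) := fun s => by
      have hz := hnd _ (hsol s)
        (fun x => by
          simp only [hwall]
          rw [hconst (x + s) x, sub_self])
        (fun x => by
          simp only [neg_neg, add_comm (φ (_, (-1 : ℝ))), hwall]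
          rw [hconst (x + s) x, sub_self])
        (0, 0) (mem_closedStrip.2 (Ioo_subset_Icc_self h00))
      simp only [zero_add, neg_zero] at hz
      linarith
    rw [show (fun s => φ (s, 0)) = fun _ => φ (0, 0) from funext heq, deriv_const]
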